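/- **Conventions.** $\mathbb{N}$ is the set of positive integers; boxes $(i,j)$ are in matrix coordinates. For a finite (skew) diagram $\theta$, $T(\theta,X)$ is the set of fillings of $\theta$ with entries in $X$, $\mathrm{SSYT}(\theta)\subset T(\theta,\mathbb{N})$ the set of semi-standard ones (rows weakly, columns strictly increasing), and $$\zeta_\theta(\boldsymbol{s})=\sum_{(m_{ij})\in \mathrm{SSYT}(\theta)}\ \prod_{(i,j)\in\theta} m_{ij}^{-s_{ij}}\qquad(\boldsymbol{s}=(s_{ij})\in T(\theta,\mathbb{C})).$$ A corner of $\theta$ is a box of $\theta$ with no box of $\theta$ directly below it and none directly to its right; $I_\theta$ is the set of $\boldsymbol{\gamma}\in T(\theta,\mathbb{N})$ whose entries in all corners are $\ge 2$. $\theta^{\#}$ and $\boldsymbol{\gamma}^{\#}$ denote the reflections of a diagram and of a tableau in the anti-diagonal (diagrams are taken up to translation). For a partition $\nu$ with $N$ boxes on the main diagonal, its Frobenius coordinates are $p_i(\nu)=\nu_i-i$ and $q_i(\nu)=\nu_i'-i$ $(1\le i\le N)$. For a partition $\nu\neq\emptyset$, a row $\lambda_*$ of $m\ge 0$ boxes and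 a column $\lambda^*$ of $n\ge0$ boxes, $[\lambda_*\mid\nu\mid\lambda^*]$ is the diagram (of winged type) obtained from $\nu$ by attaching $\lambda_*$ to the left of the most south-west box of $\nu$ and $\lambda^*$ on top of the most north-east box of $\nu$; $[\boldsymbol{s}_*\mid\boldsymbol{s}\mid\boldsymbol{s}^*]$ denotes the corresponding tableau. **Theorem 4.1.** Let $\lambda$ be a partition whose Young diagram is a non-empty rectangle, with $N$ boxes on the main diagonal, and let $\widetilde\lambda=[\lambda_*\mid\lambda\mid\lambda^*]$ be of winged type with middle part $\lambda$. Then $\widetilde\lambda^{\#}$ is the Young diagram of a partition $\mu$ (non-skew), and $\mu$ also has $N$ boxes on its main diagonal. Let $\boldsymbol{\gamma}\in T(\widetilde\lambda^{\#},\mathbb{N})$ be constant along diagonals, $\gamma_{ij}=c_{j-i}$, and put $\widetilde{\boldsymbol s}=\boldsymbol{\gamma}^{\#}=[\boldsymbol{s}_*\mid\boldsymbol{s}\mid\boldsymbol{s}^*]\in T(\widetilde\lambda,\mathbb{N})$, so that $s_{ij}=z_{j-i}$ on $\lambda$. For $1\le i,j\le N$ let $\boldsymbol{s}^F_{ij}$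 be the tableau of hook shape $(p_i(\lambda)+1,1^{q_j(\lambda)})$ with first row $z_0,z_1,\dots,z_{p_i(\lambda)}$ and first column $z_0,z_{-1},\dots,z_{-q_j(\lambda)}$, and let $\widetilde{\boldsymbol s}^F_{ij}$, of shape $\widetilde\lambda_{ij}$, be obtained from $\boldsymbol{s}^F_{ij}$ by attaching the wing $\boldsymbol{s}^*$ if and only if $i=1$, and the wing $\boldsymbol{s}_*$ if and only if $j=1$. Put $\widetilde\zeta_{i,j}=\zeta_{\widetilde\lambda_{ij}}(\widetilde{\boldsymbol s}^F_{ij})$. Let $\boldsymbol{\gamma}^F_{ij}$ be the tableau of hook shape $h_{ij}=(p_i(\mu)+1,1^{q_j(\mu)})$ with first row $c_0,c_1,\dots,c_{p_i(\mu)}$ and first column $c_0,c_{-1},\dots,c_{-q_j(\mu)}$. Assume $\widetilde{\boldsymbol s}^F_{ij}\in I_{\widetilde\lambda_{ij}}$ for all $1\le i,j\le N$. Then all the series $\zeta_{\widetilde\lambda_{ij}}(\widetilde{\boldsymbol s}^F_{ij})$ and $\zeta_{h_{ij}^{\#}}(\boldsymbol{\gamma}_{ij}^{F\#})$ converge absolutely,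 and $$\det\bigl(\widetilde\zeta_{i,j}\bigr)_{1\le i,j\le N}=\det\Bigl(\zeta_{h_{ij}^{\#}}\bigl(\boldsymbol{\gamma}_{ij}^{F\#}\bigr)\Bigr)_{1\le i,j\le N}.$$ -/

import Mathlib

namespace SchurMZF

/-! Boxes are pairs `(row, column)` of natural numbers in matrix coordinates, counted from `0`.
A diagram is a finite set of boxes. -/

/-- `T(θ, X)`: the tableaux of shape `θ` with entries in `X`. -/
abbrev Tableau (θ : Finset (ℕ × ℕ)) (X : Type*) : Type _ := ↥θ → X

/-- Rows weakly increase from left to right, columns strictly increase from top to bottom. -/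
structure IsSemistandard {θ : Finset (ℕ × ℕ)} (M : Tableau θ ℕ+) : Prop where
  row_weak : ∀ x y : ↥θ, x.1.1 = y.1.1 → x.1.2 < y.1.2 → M x ≤ M y
  col_strict : ∀ x y : ↥θ, x.1.2 = y.1.2 → x.1.1 < y.1.1 → M x < M y

/-- `SSYT(θ)`. -/
def SSYT (θ : Finset (ℕ × ℕ)) : Type := {M : Tableau θ ℕ+ // IsSemistandard M}

/-- `w(s, M) = 1 / ∏ m_{ij} ^ s_{ij}`. -/
noncomputable def weight {θ : Finset (ℕ × ℕ)} (s : Tableau θ ℂ) (M : SSYT θ) : ℂ :=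
  1 / ∏ x : ↥θ, ((M.1 x : ℕ) : ℂ) ^ s x

/-- The Schur multiple zeta-function attached to `θ`. -/
noncomputable def schurZeta {θ : Finset (ℕ × ℕ)} (s : Tableau θ ℂ) : ℂ :=
  ∑' M : SSYT θ, weight s M

/-- The series defining `ζ_θ(s)` converges (in `ℂ` this is absolute convergence). -/
def ZetaConverges {θ : Finset (ℕ × ℕ)} (s : Tableau θ ℂ) : Prop :=
  Summable fun M : SSYT θ => weight s M

/-- A tableau of positive integers regarded as a tableau of complex numbers. -/
def toComplex {θ : Finset (ℕ × ℕ)} (γ : Tableau θ ℕ+) : Tableau θ ℂ := fun x => ((γ x : ℕ) : ℂ)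

/-- `x ∈ C(θ)`: no box of `θ` directly below and none directly to the right. -/
def IsCorner (θ : Finset (ℕ × ℕ)) (x : ℕ × ℕ) : Prop :=
  x ∈ θ ∧ (x.1 + 1, x.2) ∉ θ ∧ (x.1, x.2 + 1) ∉ θ

/-- `γ ∈ I_θ`: every entry in a corner is at least `2`. -/
def Admissible {θ : Finset (ℕ × ℕ)} (γ : Tableau θ ℕ+) : Prop :=
  ∀ x : ↥θ, IsCorner θ x.1 → 2 ≤ γ x

/-- The index of the lowest row met by `θ`. -/
def lastRow (θ : Finset (ℕ × ℕ)) : ℕ := θ.sup Prod.fst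

/-- The index of the right-most column met by `θ`. -/
def lastCol (θ : Finset (ℕ × ℕ)) : ℕ := θ.sup Prod.snd

/-- `θ^#`: the reflection of `θ` in the anti-diagonal, placed so that the last column of `θ`
becomes row `0` and the last row of `θ` becomes column `0`. -/
def sharp (θ : Finset (ℕ × ℕ)) : Finset (ℕ × ℕ) :=
  θ.image fun x => (lastCol θ - x.2, lastRow θ - x.1)

theorem mem_of_mem_sharp {θ : Finset (ℕ × ℕ)} {y : ℕ × ℕ} (hy : y ∈ sharp θ) :
    (lastRow θ - y.2, lastCol θ - y.1) ∈ θ := by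
  obtain ⟨x, hx, rfl⟩ := Finset.mem_image.1 hy
  have h1 : x.1 ≤ lastRow θ := Finset.le_sup (f := Prod.fst) hx
  have h2 : x.2 ≤ lastCol θ := Finset.le_sup (f := Prod.snd) hx
  simpa [Nat.sub_sub_self h1, Nat.sub_sub_self h2] using hx

/-- `γ^#`: the reflection of the tableau `γ` in the anti-diagonal. -/
def Tableau.sharp {θ : Finset (ℕ × ℕ)} {X : Type*} (γ : Tableau θ X) :
    Tableau (SchurMZF.sharp θ) X :=
  fun y => γ ⟨(lastRow θ - y.1.2, lastCol θ - y.1.1), mem_of_mem_sharp y.2⟩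

/-- The tableau of shape `θ` whose entry in the box `(i, j)` is `z_{j - i}`. -/
def contentTableau (θ : Finset (ℕ × ℕ)) {X : Type*} (z : ℤ → X) : Tableau θ X :=
  fun x => z ((x.1.2 : ℤ) - (x.1.1 : ℤ))

/-- `N`: the number of boxes on the main diagonal. -/
def diagLen (lam : YoungDiagram) : ℕ := (lam.cells.filter fun x => x.1 = x.2).card

/-- The Frobenius arm length `p_{i+1} = λ_{i+1} - (i+1)`, for `i < N` (rows are counted from `0`). -/
def frobP (lam : YoungDiagram) (i : ℕ) : ℕ := lam.rowLen i - (i + 1)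

/-- The Frobenius leg length `q_{j+1} = λ'_{j+1} - (j+1)`, for `j < N`. -/
def frobQ (lam : YoungDiagram) (j : ℕ) : ℕ := lam.colLen j - (j + 1)

/-- The hook `(p + 1, 1^q)`. -/
def hook (p q : ℕ) : YoungDiagram where
  cells := (Finset.range (q + 1) ×ˢ Finset.range (p + 1)).filter fun x => x.1 = 0 ∨ x.2 = 0
  isLowerSet := by
    rintro ⟨a, b⟩ ⟨c, d⟩ ⟨h1, h2⟩ h
    simp only [Finset.coe_filter, Finset.mem_product, Finset.mem_range, Set.mem_ofPred_eq] at *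
    omega

/-- A non-empty rectangle. -/
def IsRectangle (lam : YoungDiagram) : Prop :=
  ∃ a b : ℕ, 0 < a ∧ 0 < b ∧ lam.cells = Finset.range a ×ˢ Finset.range b

/-- The winged diagram `[λ_* | λ | λ^*]` for non-empty `λ`, where `λ_*` is a row of `m` boxes and
`λ^*` a column of `n` boxes. The body `λ` is moved `n` rows down and `m` columns to the right;
the row is attached to the left of the most south-west box of the body, and the column on top of
its most north-east box. -/
def winged (m : ℕ) (lam : YoungDiagram) (n : ℕ) : Finset (ℕ × ℕ) :=
  lam.cells.image (fun x => (n + x.1, m + x.2)) ∪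
    (Finset.range m).image (fun k => (n + (lam.colLen 0 - 1), k)) ∪
    (Finset.range n).image (fun k => (k, m + (lam.rowLen 0 - 1)))

theorem mem_body_of_mem_winged {m n : ℕ} {lam : YoungDiagram} {x : ℕ × ℕ}
    (hx : x ∈ winged m lam n) (hj : ¬ x.2 < m) (hi : ¬ x.1 < n) :
    (x.1 - n, x.2 - m) ∈ lam.cells := by
  simp only [winged, Finset.mem_union, Finset.mem_image, Finset.mem_range] at hx
  rcases hx with (⟨y, hy, rfl⟩ | ⟨k, hk, rfl⟩) | ⟨k, hk, rfl⟩
  · simpa using hy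
  · exact absurd hk hj
  · exact absurd hk hi

/-- The tableau `[s_* | s | s^*]`. The row `s_*` is read from left to right and the column `s^*`
from top to bottom. -/
def wingedTableau {m n : ℕ} {lam : YoungDiagram} {X : Type*}
    (sl : Fin m → X) (s : Tableau lam.cells X) (su : Fin n → X) : Tableau (winged m lam n) X :=
  fun x =>
    if hj : x.1.2 < m then sl ⟨x.1.2, hj⟩
    else if hi : x.1.1 < n then su ⟨x.1.1, hi⟩
    else s ⟨(x.1.1 - n, x.1.2 - m), mem_body_of_mem_winged x.2 hj hi⟩

/-- The wing `s` if `P` holds, and the empty wing otherwise. -/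
def wingIf (P : Prop) [Decidable P] {m : ℕ} {X : Type*} (s : Fin m → X) :
    Fin (if P then m else 0) → X :=
  fun k => s (Fin.castLE (by split_ifs <;> omega) k)

/-- `s̃_{ij}^F`, of shape `λ̃_{ij}`, for the tableau `[s_* | s | s^*]` with `s_{ij} = z_{j-i}` on `λ`:
the hook `(p_i + 1, 1^{q_j})` filled with the `z_k`, together with the upper wing exactly when `i`
is the first index, and the left wing exactly when `j` is the first index. -/
def tildeHook (lam : YoungDiagram) {m n : ℕ} {X : Type*} (sl : Fin m → X) (z : ℤ → X)
    (su : Fin n → X) (i j : ℕ) :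
    Tableau (winged (if j = 0 then m else 0) (hook (frobP lam i) (frobQ lam j))
      (if i = 0 then n else 0)) X :=
  wingedTableau (wingIf (j = 0) sl)
    (contentTableau (hook (frobP lam i) (frobQ lam j)).cells z) (wingIf (i = 0) su)

/-- `γ_{ij}^{F#}`, of shape `(p_i + 1, 1^{q_j})^#`, where `γ_{ij} = c_{j-i}` on `μ` and
`p`, `q` are the Frobenius coordinates of `μ`. -/
def sharpHook (mu : YoungDiagram) {X : Type*} (c : ℤ → X) (i j : ℕ) :
    Tableau (sharp (hook (frobP mu i) (frobQ mu j)).cells) X :=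
  Tableau.sharp (contentTableau (hook (frobP mu i) (frobQ mu j)).cells c)

end SchurMZF

open SchurMZF

namespace SchurMZF

/-! Let `λ` have `a` rows and `b` columns. Every shape in the two determinants is a ribbon. Read
from its south-west end and numbered by the index of `c`, the ribbon in position `(i, j)` carries
the exponents `c_t` for `t` from `-q_j(μ)` to `p_i(μ)`, on both sides. Only the pattern of up and
right steps differs, and on each side a single pattern on `ℤ` serves all `N²` ribbons. The wings fit
because only the first arm and the first leg of `μ` are lengthened by them.

Reversing one step gives a relation: the conditions `y < x` and `x ≤ y` are complementary, so the
old and new sums add up to the product of the sums over the two pieces cut at that step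
(`chainSum_flip`). If the step comes just after box `p_k(μ)`, the first piece is the entry in row
`k`, so each longer row is negated and gains a multiple of row `k`; the determinant acquires the
sign of the number of rows above `k`. Reversing the step just before box `-q_k(μ)` does the same to
columns, with the same sign. Performing both preserves the determinant
(`det_chainMatrix_flip_both`), and doing so for every `k` but the first turns one pattern into the
other (`det_chainMatrix_stepPattern`).

These identities are proved with entries restricted to a finite set `s`. Absolute convergence
(`Admissible.zetaConverges`) and continuity of the determinant allow `s` to exhaust the positive
integers. -/

theorem sum_piFinset_snoc {κ M : Type*} [AddCommMonoid M] (s : Finset κ) (K : ℕ)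
    (F : (Fin (K + 1) → κ) → M) :
    ∑ f ∈ Fintype.piFinset (fun _ : Fin (K + 1) => s), F f =
      ∑ f ∈ Fintype.piFinset (fun _ : Fin K => s), ∑ x ∈ s, F (Fin.snoc f x) := by
  rw [← Finset.sum_product']
  symm
  refine Finset.sum_bij' (fun a _ => Fin.snoc a.1 a.2) (fun f _ => (Fin.init f, f (Fin.last K)))
    ?_ ?_ ?_ ?_ ?_
  · rintro ⟨f, x⟩ h
    simp only [Finset.mem_product, Fintype.mem_piFinset] at h ⊢
    intro k
    induction k using Fin.lastCases with
    | last => simpa using h.2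
    | cast k => simpa using h.1 k
  · intro f h
    simp only [Finset.mem_product, Fintype.mem_piFinset] at h ⊢
    exact ⟨fun k => h _, h _⟩
  · rintro ⟨f, x⟩ h
    simp
  · intro f h
    simp
  · intro f h
    rfl

/-! ### Ribbon sums over a finite alphabet and step reversal -/

section Chain

variable {ι R : Type*} [LinearOrder ι] [CommRing R]

/-- The relation between the entries of two consecutive boxes of a ribbon read from its south-west
end: the second box lies above the first one if `up` holds, and to its right otherwise. -/
def StepRel (up : Prop) (x y : ι) : Prop := (up → y < x) ∧ (¬ up → x ≤ y)

open Classical in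
/-- The indicator function of `StepRel`. -/
noncomputable def stepInd (R : Type*) [CommRing R] (up : Prop) (x y : ι) : R :=
  if StepRel up x y then 1 else 0

theorem stepInd_add_not (up : Prop) (x y : ι) :
    stepInd R up x y + stepInd R (¬ up) x y = 1 := by
  by_cases h : up <;> rcases lt_or_ge y x with hyx | hxy <;>
    simp [stepInd, StepRel, *]

/-- The weighted sum over the fillings of a ribbon with entries in `s`, with the entry in the last
box equal to `x`. The boxes are numbered `l, …, l + k`. -/
noncomputable def chainVec (w : ℤ → ι → R) (P : ℤ → Prop) (s : Finset ι) (l : ℤ) : ℕ → ι → R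
  | 0, x => w l x
  | k + 1, x => (∑ y ∈ s, chainVec w P s l k y * stepInd R (P (l + k)) y x) * w (l + k + 1) x

/-- The weighted sum over the fillings with entries in `s` of a ribbon with boxes numbered
`l, …, l + k`. -/
noncomputable def chainSum (w : ℤ → ι → R) (P : ℤ → Prop) (s : Finset ι) (l : ℤ) (k : ℕ) : R :=
  ∑ x ∈ s, chainVec w P s l k x

theorem chainVec_congr (w : ℤ → ι → R) {P Q : ℤ → Prop} (s : Finset ι) (l : ℤ) (k : ℕ)
    (h : ∀ u, l ≤ u → u < l + k → (P u ↔ Q u)) : chainVec w P s l k = chainVec w Q s l k := by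
  induction k with
  | zero => rfl
  | succ k ih =>
    funext x
    have h1 : P (l + k) = Q (l + k) := propext (h _ (by omega) (by push_cast; omega))
    simp only [chainVec, h1]
    rw [ih fun u h1 h2 => h u h1 (by push_cast; omega)]

theorem chainSum_congr (w : ℤ → ι → R) {P Q : ℤ → Prop} (s : Finset ι) (l : ℤ) (k : ℕ)
    (h : ∀ u, l ≤ u → u < l + k → (P u ↔ Q u)) : chainSum w P s l k = chainSum w Q s l k := by
  simp only [chainSum, chainVec_congr w s l k h]

/-- At the reversed step the two indicators add up to `1`, so the ribbon falls apart there. The last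
entry `x` is kept fixed so that the identity propagates box by box through the recursion. -/
theorem chainVec_add_flip (w : ℤ → ι → R) {P Q : ℤ → Prop} (s : Finset ι) (l : ℤ) (p : ℕ)
    (hflip : Q (l + p) ↔ ¬ P (l + p)) (h : ∀ u, u ≠ l + p → (P u ↔ Q u)) (k : ℕ) (x : ι) :
    chainVec w P s l (p + 1 + k) x + chainVec w Q s l (p + 1 + k) x =
      chainSum w P s l p * chainVec w P s (l + p + 1) k x := by
  induction k generalizing x with
  | zero =>
    have h1 : chainVec w Q s l p = chainVec w P s l p :=
      chainVec_congr w s l p fun u _ h2 => (h u (by omega)).symm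
    have h2 : Q (l + p) = ¬ P (l + p) := propext hflip
    simp only [chainVec, h1, h2, chainSum, ← add_mul, ← Finset.sum_add_distrib, ← mul_add,
      stepInd_add_not, mul_one]
  | succ k ih =>
    have h1 : Q (l + ((p + 1 + k : ℕ) : ℤ)) = P (l + p + 1 + k) := by
      rw [show l + ((p + 1 + k : ℕ) : ℤ) = l + p + 1 + k by push_cast; ring]
      exact propext (h _ (by omega)).symm
    have h2 : P (l + ((p + 1 + k : ℕ) : ℤ)) = P (l + p + 1 + k) := by
      congr 1; push_cast; ring
    have h3 : l + ((p + 1 + k : ℕ) : ℤ) + 1 = l + p + 1 + k + 1 := by push_cast; ring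
    rw [← add_assoc]
    simp only [chainVec, h1, h2, h3]
    rw [← add_mul, ← Finset.sum_add_distrib, ← mul_assoc, Finset.mul_sum]
    congr 1
    refine Finset.sum_congr rfl fun y _ => ?_
    rw [← add_mul, ih, mul_assoc]

theorem chainSum_flip (w : ℤ → ι → R) {P Q : ℤ → Prop} (s : Finset ι) (l : ℤ) (p : ℕ)
    (hflip : Q (l + p) ↔ ¬ P (l + p)) (h : ∀ u, u ≠ l + p → (P u ↔ Q u)) (k : ℕ) :
    chainSum w Q s l (p + 1 + k) = - chainSum w P s l (p + 1 + k) +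
      chainSum w P s l p * chainSum w P s (l + p + 1) k := by
  have := Finset.sum_congr (rfl : s = s) fun x _ => chainVec_add_flip w s l p hflip h k x
  rw [Finset.sum_add_distrib, ← Finset.mul_sum] at this
  unfold chainSum at *
  linear_combination this

/-- The matrix of the sums over the ribbons with boxes numbered `-l j, …, r i`. -/
noncomputable def chainMatrix {N : ℕ} (w : ℤ → ι → R) (P : ℤ → Prop) (s : Finset ι)
    (l r : ℕ → ℕ) : Matrix (Fin N) (Fin N) R :=
  Matrix.of fun i j => chainSum w P s (-(l j : ℤ)) (l j + r i)

/-- Row `k` is itself unchanged, so adding its multiples is an elementary operation on the matrix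
whose earlier rows have been negated. -/
theorem det_eq_of_flipped_rows {N : ℕ} {A B : Matrix (Fin N) (Fin N) R} (k : Fin N) (α : Fin N → R)
    (h1 : ∀ i j, i < k → B i j = - A i j + α i * A k j) (h2 : ∀ i j, k ≤ i → B i j = A i j) :
    B.det = (∏ i : Fin N, if i < k then -1 else 1) * A.det := by
  rw [← Matrix.det_mul_column]
  refine Matrix.det_eq_of_forall_row_eq_smul_add_const (fun i => if i < k then α i else 0) k
    (by simp) fun i j => ?_
  by_cases hi : i < k
  · simp [hi, h1 i j hi]
  · simp [hi, h2 i j (not_lt.1 hi)]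

theorem det_chainMatrix_flip_right {N : ℕ} (w : ℤ → ι → R) {P Q : ℤ → Prop} (s : Finset ι)
    {l r : ℕ → ℕ} (hr : StrictAntiOn r (Set.Iio N)) (k : Fin N)
    (hflip : Q (r k) ↔ ¬ P (r k)) (h : ∀ u : ℤ, u ≠ r k → (P u ↔ Q u)) :
    (chainMatrix w Q s l r : Matrix (Fin N) (Fin N) R).det =
      (∏ i : Fin N, if i < k then -1 else 1) *
        (chainMatrix w P s l r : Matrix (Fin N) (Fin N) R).det := by
  refine det_eq_of_flipped_rows k
    -- The multiplier is the piece with boxes `r k + 1, …, r i`; it does not depend on the column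
    -- `j`.
    (fun i => chainSum w P s ((r k : ℤ) + 1) (r i - r k - 1)) (fun i j hik => ?_) fun i j hik => ?_
  · have hlt : r k < r i := hr i.2 k.2 hik
    have e : -(l j : ℤ) + ((l j + r k : ℕ) : ℤ) = r k := by push_cast; ring
    have := chainSum_flip w (P := P) (Q := Q) s (-(l j : ℤ)) (l j + r k) (by rwa [e])
      (by rwa [e]) (r i - r k - 1)
    rw [e, show l j + r k + 1 + (r i - r k - 1) = l j + r i by omega] at this
    simp only [chainMatrix, Matrix.of_apply]
    rw [this, mul_comm (chainSum w P s (-(l j : ℤ)) _)]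
  · have hle : r i ≤ r k := hr.antitoneOn k.2 i.2 hik
    exact chainSum_congr w s _ _ fun u _ h2 => (h u (by push_cast at h2; omega)).symm

theorem det_chainMatrix_flip_left {N : ℕ} (w : ℤ → ι → R) {P Q : ℤ → Prop} (s : Finset ι)
    {l r : ℕ → ℕ} (hl : StrictAntiOn l (Set.Iio N)) (k : Fin N)
    (hflip : Q (-(l k : ℤ) - 1) ↔ ¬ P (-(l k : ℤ) - 1))
    (h : ∀ u : ℤ, u ≠ -(l k : ℤ) - 1 → (P u ↔ Q u)) :
    (chainMatrix w Q s l r : Matrix (Fin N) (Fin N) R).det =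
      (∏ i : Fin N, if i < k then -1 else 1) *
        (chainMatrix w P s l r : Matrix (Fin N) (Fin N) R).det := by
  rw [← Matrix.det_transpose, ← Matrix.det_transpose (chainMatrix w P s l r)]
  refine det_eq_of_flipped_rows k
    (fun j => chainSum w P s (-(l j : ℤ)) (l j - l k - 1)) (fun j i hjk => ?_) fun j i hjk => ?_
  · have hlt : l k < l j := hl j.2 k.2 hjk
    have e : -(l j : ℤ) + ((l j - l k - 1 : ℕ) : ℤ) = -(l k : ℤ) - 1 := by omega
    have := chainSum_flip w (P := P) (Q := Q) s (-(l j : ℤ)) (l j - l k - 1) (by rwa [e])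
      (by rwa [e]) (l k + r i)
    rw [e, show l j - l k - 1 + 1 + (l k + r i) = l j + r i by omega, sub_add_cancel] at this
    simpa only [chainMatrix, Matrix.of_apply, Matrix.transpose_apply] using this
  · have hle : l j ≤ l k := hl.antitoneOn k.2 j.2 hjk
    exact chainSum_congr w s _ _ fun u h1 _ => (h u (by omega)).symm

theorem det_chainMatrix_flip_both {N : ℕ} (w : ℤ → ι → R) {P Q : ℤ → Prop} (s : Finset ι)
    {l r : ℕ → ℕ} (hl : StrictAntiOn l (Set.Iio N)) (hr : StrictAntiOn r (Set.Iio N)) (k : Fin N)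
    (hflipr : Q (r k) ↔ ¬ P (r k))
    (hflipl : Q (-(l k : ℤ) - 1) ↔ ¬ P (-(l k : ℤ) - 1))
    (h : ∀ u : ℤ, u ≠ r k → u ≠ -(l k : ℤ) - 1 → (P u ↔ Q u)) :
    (chainMatrix w Q s l r : Matrix (Fin N) (Fin N) R).det =
      (chainMatrix w P s l r : Matrix (Fin N) (Fin N) R).det := by
  -- Intermediate pattern with only the right-hand step reversed. The two steps are distinct since
  -- `-(l k) - 1 < 0 ≤ r k`.
  let P' : ℤ → Prop := fun u => if u = r k then Q u else P u
  have hne : -(l k : ℤ) - 1 ≠ r k := by omega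
  rw [det_chainMatrix_flip_left w (P := P') (Q := Q) s hl k (by simp [P', hne, hflipl])
      (fun u hu => by
        by_cases hu' : u = r k
        · simp [P', hu']
        · simp [P', hu', h u hu' hu]),
    det_chainMatrix_flip_right w (P := P) (Q := P') s hr k (by simp [P', hflipr])
      (fun u hu => by simp [P', hu]), ← mul_assoc, ← Finset.prod_mul_distrib,
    Finset.prod_eq_one, one_mul]
  intro i _
  split_ifs <;> simp

/-- The products of the weights along a ribbon with boxes numbered `l, …, l + K`, if the filling
`f` is admissible, and `0` otherwise. -/
noncomputable def chainTerm (w : ℤ → ι → R) (P : ℤ → Prop) (l : ℤ) (K : ℕ)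
    (f : Fin (K + 1) → ι) : R :=
  (∏ k : Fin (K + 1), w (l + k) (f k)) *
    ∏ k : Fin K, stepInd R (P (l + k)) (f k.castSucc) (f k.succ)

theorem chainTerm_snoc (w : ℤ → ι → R) (P : ℤ → Prop) (l : ℤ) (K : ℕ) (f : Fin (K + 1) → ι)
    (x : ι) : chainTerm w P l (K + 1) (Fin.snoc f x) =
      chainTerm w P l K f * (stepInd R (P (l + K)) (f (Fin.last K)) x * w (l + K + 1) x) := by
  unfold chainTerm
  rw [Fin.prod_univ_castSucc (n := K + 1), Fin.prod_univ_castSucc (n := K)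
    fun k => stepInd R (P (l + k)) _ _]
  have h1 : ∀ k : Fin K, (Fin.snoc f x : Fin (K + 2) → ι) k.castSucc.succ = f k.succ := by
    intro k
    rw [← Fin.castSucc_succ, Fin.snoc_castSucc]
  have h2 : (Fin.snoc f x : Fin (K + 2) → ι) (Fin.last K).succ = x := by
    rw [Fin.succ_last, Fin.snoc_last]
  simp only [Fin.snoc_castSucc, Fin.snoc_last, h1, h2, Fin.val_castSucc, Fin.val_last]
  push_cast
  rw [add_assoc l]
  ring

/-- The test function `h` on the last entry makes the induction close: summing out a new last box
only replaces `h` by another function of the previous entry. -/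
theorem sum_chainTerm_mul (w : ℤ → ι → R) (P : ℤ → Prop) (s : Finset ι) (l : ℤ) (K : ℕ)
    (h : ι → R) :
    ∑ f ∈ Fintype.piFinset (fun _ : Fin (K + 1) => s), chainTerm w P l K f * h (f (Fin.last K)) =
      ∑ x ∈ s, chainVec w P s l K x * h x := by
  induction K generalizing h with
  | zero =>
    rw [sum_piFinset_snoc]
    simp [chainTerm, chainVec, Fin.snoc]
  | succ K ih =>
    rw [sum_piFinset_snoc]
    simp only [chainTerm_snoc, Fin.snoc_last, chainVec]
    simp only [mul_assoc, ← Finset.mul_sum]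
    rw [ih fun y => ∑ x ∈ s, stepInd R (P (l + K)) y x * (w (l + K + 1) x * h x)]
    simp only [Finset.mul_sum, Finset.sum_mul]
    rw [Finset.sum_comm]
    simp only [mul_assoc]

theorem sum_chainTerm (w : ℤ → ι → R) (P : ℤ → Prop) (s : Finset ι) (l : ℤ) (K : ℕ) :
    ∑ f ∈ Fintype.piFinset (fun _ : Fin (K + 1) => s), chainTerm w P l K f =
      chainSum w P s l K := by
  simpa [chainSum] using sum_chainTerm_mul w P s l K 1

end Chain

/-! ### Absolute convergence -/

/-- Every box is dominated by a corner. -/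
theorem exists_corner_ge {θ : Finset (ℕ × ℕ)} (x : ↥θ) :
    ∃ y : ↥θ, IsCorner θ y.1 ∧ ∀ M : Tableau θ ℕ+, IsSemistandard M → M x ≤ M y := by
  induction hd : lastRow θ + lastCol θ - (x.1.1 + x.1.2) using Nat.strong_induction_on
    generalizing x with
  | _ d ih =>
    have hbound : ∀ y ∈ θ, y.1 + y.2 ≤ lastRow θ + lastCol θ := fun y hy =>
      add_le_add (Finset.le_sup (f := Prod.fst) hy) (Finset.le_sup (f := Prod.snd) hy)
    by_cases h1 : (x.1.1 + 1, x.1.2) ∈ θ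
    · have hb := hbound _ h1
      obtain ⟨y, hy, hM⟩ := ih _ (by simp only at hb ⊢; omega) ⟨_, h1⟩ rfl
      exact ⟨y, hy, fun M hMs => (hMs.col_strict x ⟨_, h1⟩ rfl (Nat.lt_succ_self _)).le.trans
        (hM M hMs)⟩
    · by_cases h2 : (x.1.1, x.1.2 + 1) ∈ θ
      · have hb := hbound _ h2
        obtain ⟨y, hy, hM⟩ := ih _ (by simp only at hb ⊢; omega) ⟨_, h2⟩ rfl
        exact ⟨y, hy, fun M hMs => (hMs.row_weak x ⟨_, h2⟩ rfl (Nat.lt_succ_self _)).trans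
          (hM M hMs)⟩
      · exact ⟨x, ⟨x.2, h1, h2⟩, fun _ _ => le_rfl⟩

/-- Any finite set of functions lies in a finite box, over which the sum factors into partial sums
of `u`. -/
theorem summable_pi_prod {α β : Type*} [Fintype α] {u : β → ℝ} (hu : Summable u)
    (h0 : ∀ b, 0 ≤ u b) : Summable fun f : α → β => ∏ a, u (f a) := by
  classical
  refine summable_of_sum_le (c := ∏ _a : α, ∑' b, u b)
    (fun f => Finset.prod_nonneg fun a _ => h0 _) fun S => ?_
  calc ∑ f ∈ S, ∏ a, u (f a)
      ≤ ∑ f ∈ Fintype.piFinset (fun a => S.image fun f => f a), ∏ a, u (f a) := by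
        refine Finset.sum_le_sum_of_subset_of_nonneg (fun f hf => ?_)
          fun f _ _ => Finset.prod_nonneg fun a _ => h0 _
        exact Fintype.mem_piFinset.2 fun a => Finset.mem_image_of_mem _ hf
    _ = ∏ a, ∑ b ∈ S.image fun f => f a, u b := (Finset.prod_univ_sum _ _).symm
    _ ≤ _ := Finset.prod_le_prod (fun a _ => Finset.sum_nonneg fun b _ => h0 b)
        fun a _ => hu.sum_le_tsum _ fun b _ => h0 b

/-- Let `V` be the product of all entries and `P` that of the corner entries. Admissibility makes
the denominator at least `V * P`. Each entry is at most some corner entry, hence at most `P`, so `P`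
is at least a fixed positive power of `V`: the surplus at the corners is shared among all boxes,
giving each an exponent above `1`. -/
theorem norm_weight_le {θ : Finset (ℕ × ℕ)} {γ : Tableau θ ℕ+} (hγ : Admissible γ)
    (M : SSYT θ) :
    ‖weight (toComplex γ) M‖ ≤
      ∏ x : ↥θ, ((M.1 x : ℕ) : ℝ) ^ (-(1 + 1 / ((θ.card : ℝ) + 1))) := by
  classical
  set v : ↥θ → ℝ := fun x => ((M.1 x : ℕ) : ℝ) with hv
  have hv1 : ∀ x, 1 ≤ v x := fun x => by simp only [hv]; exact_mod_cast (M.1 x).pos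
  have hv0 : ∀ x, 0 < v x := fun x => one_pos.trans_le (hv1 x)
  set P : ℝ := ∏ x : ↥θ, if IsCorner θ x.1 then v x else 1 with hP
  have hfac : ∀ x : ↥θ, (1 : ℝ) ≤ if IsCorner θ x.1 then v x else 1 := fun x => by
    split_ifs
    exacts [hv1 x, le_rfl]
  have hP1 : 1 ≤ P := Finset.one_le_prod fun x _ => hfac x
  have hvP : ∀ x, v x ≤ P := by
    intro x
    obtain ⟨y, hy, hxy⟩ := exists_corner_ge x
    calc v x ≤ v y := by simp only [hv]; exact_mod_cast hxy M.1 M.2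
      _ = if IsCorner θ y.1 then v y else 1 := by simp [hy]
      _ ≤ P := by
        rw [hP, ← Finset.mul_prod_erase _ _ (Finset.mem_univ y)]
        exact le_mul_of_one_le_right (zero_le_one.trans (hfac y))
          (Finset.one_le_prod fun x _ => hfac x)
  set V : ℝ := ∏ x, v x with hV
  have hV0 : 0 < V := Finset.prod_pos fun x _ => hv0 x
  -- Using `θ.card + 1` instead of `θ.card` keeps the root meaningful for the empty diagram.
  have hVP : V ≤ P ^ (θ.card + 1) := by
    calc V ≤ ∏ _x : ↥θ, P := Finset.prod_le_prod (fun x _ => (hv0 x).le) fun x _ => hvP x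
      _ = P ^ θ.card := by simp
      _ ≤ _ := pow_le_pow_right₀ hP1 (Nat.le_succ _)
  have hroot : V ^ (1 / ((θ.card : ℝ) + 1)) ≤ P := by
    calc V ^ (1 / ((θ.card : ℝ) + 1)) ≤ (P ^ (θ.card + 1)) ^ (1 / ((θ.card : ℝ) + 1)) :=
          Real.rpow_le_rpow hV0.le hVP (by positivity)
      _ = P := by
        rw [one_div, ← Nat.cast_add_one, Real.pow_rpow_inv_natCast (by linarith) (by omega)]
  have hmain : V * P ≤ ∏ x, v x ^ (γ x : ℕ) := by
    rw [hV, hP, ← Finset.prod_mul_distrib]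
    refine Finset.prod_le_prod (fun x _ => mul_nonneg (hv0 x).le (zero_le_one.trans (hfac x)))
      fun x _ => ?_
    split_ifs with hx
    · have h2 : 2 ≤ (γ x : ℕ) := by exact_mod_cast hγ x hx
      calc v x * v x = v x ^ 2 := (sq _).symm
        _ ≤ _ := pow_le_pow_right₀ (hv1 x) h2
    · calc v x * 1 = v x ^ 1 := by simp
        _ ≤ _ := pow_le_pow_right₀ (hv1 x) (γ x).pos
  have hnorm : ‖weight (toComplex γ) M‖ = (∏ x, v x ^ (γ x : ℕ))⁻¹ := by
    simp [weight, toComplex, hv, Complex.cpow_natCast, norm_prod]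
  rw [hnorm, Real.finsetProd_rpow _ _ fun x _ => (hv0 x).le, Real.rpow_neg hV0.le]
  refine inv_anti₀ (Real.rpow_pos_of_pos hV0 _) ?_
  rw [Real.rpow_add hV0, Real.rpow_one]
  exact (mul_le_mul_of_nonneg_left hroot hV0.le).trans hmain

/-- The series attached to a tableau in `I_θ` converges. -/
theorem Admissible.zetaConverges {θ : Finset (ℕ × ℕ)} {γ : Tableau θ ℕ+} (hγ : Admissible γ) :
    ZetaConverges (toComplex γ) := by
  have hs : Summable fun k : ℕ+ => ((k : ℕ) : ℝ) ^ (-(1 + 1 / ((θ.card : ℝ) + 1))) := by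
    refine (Real.summable_nat_rpow.2 ?_).comp_injective PNat.coe_injective
    have : 0 < 1 / ((θ.card : ℝ) + 1) := by positivity
    linarith
  refine Summable.of_norm_bounded ((summable_pi_prod hs fun b => by positivity).comp_injective
    (Subtype.val_injective : Function.Injective fun M : SSYT θ => M.1)) fun M => ?_
  exact norm_weight_le hγ M

/-! ### Semistandard fillings of ribbons as chains -/

/-- `pos 0, …, pos K` are the boxes of the ribbon `θ`, read from its south-west end; `up k` tells
whether the box `pos (k + 1)` lies above `pos k` or to its right. -/
structure IsRibbonPath (θ : Finset (ℕ × ℕ)) (K : ℕ) (up : ℕ → Prop) (pos : ℕ → ℕ × ℕ) :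
    Prop where
  mem : ∀ k ≤ K, pos k ∈ θ
  surj : ∀ x ∈ θ, ∃ k ≤ K, pos k = x
  step_up : ∀ k < K, up k → (pos k).1 = (pos (k + 1)).1 + 1 ∧ (pos k).2 = (pos (k + 1)).2
  step_right : ∀ k < K, ¬ up k → (pos (k + 1)).1 = (pos k).1 ∧ (pos (k + 1)).2 = (pos k).2 + 1

namespace IsRibbonPath

variable {θ : Finset (ℕ × ℕ)} {K : ℕ} {up : ℕ → Prop} {pos : ℕ → ℕ × ℕ}

/-- Column minus row grows by one at every step, up or right; the additive form avoids truncated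
subtraction. -/
theorem content (h : IsRibbonPath θ K up pos) {k : ℕ} (hk : k ≤ K) :
    (pos k).2 + (pos 0).1 = (pos 0).2 + (pos k).1 + k := by
  induction k with
  | zero => omega
  | succ k ih =>
    have := ih (by omega)
    by_cases hu : up k
    · have := h.step_up k hk hu
      omega
    · have := h.step_right k hk hu
      omega

theorem injOn (h : IsRibbonPath θ K up pos) {k k' : ℕ} (hk : k ≤ K) (hk' : k' ≤ K)
    (e : pos k = pos k') : k = k' := by
  have h1 := h.content hk
  have h2 := h.content hk'
  rw [e] at h1
  omega

theorem row_le_and_col_le (h : IsRibbonPath θ K up pos) {k : ℕ} (d : ℕ) (hk : k + d ≤ K) :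
    (pos (k + d)).1 ≤ (pos k).1 ∧ (pos k).2 ≤ (pos (k + d)).2 := by
  induction d with
  | zero => simp
  | succ d ih =>
    have := ih (by omega)
    rw [← add_assoc]
    by_cases hu : up (k + d)
    · have := h.step_up (k + d) (by omega) hu
      omega
    · have := h.step_right (k + d) (by omega) hu
      omega

theorem le_of_row_eq (h : IsRibbonPath θ K up pos) {g : ℕ → ℕ+}
    (hg : ∀ k < K, StepRel (up k) (g k) (g (k + 1))) {k : ℕ} (d : ℕ) (hk : k + d ≤ K)
    (e : (pos (k + d)).1 = (pos k).1) : g k ≤ g (k + d) := by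
  induction d with
  | zero => rfl
  | succ d ih =>
    have h1 := (h.row_le_and_col_le d (by omega : k + d ≤ K)).1
    rw [← add_assoc] at e ⊢
    by_cases hu : up (k + d)
    · have := h.step_up (k + d) (by omega) hu
      omega
    · have := h.step_right (k + d) (by omega) hu
      exact (ih (by omega) (by omega)).trans ((hg (k + d) (by omega)).2 hu)

/-- A path that stays in one column only moves up. The weak inequality is carried along to cover `d
= 0` in the induction. -/
theorem le_of_col_eq (h : IsRibbonPath θ K up pos) {g : ℕ → ℕ+}
    (hg : ∀ k < K, StepRel (up k) (g k) (g (k + 1))) {k : ℕ} (d : ℕ) (hk : k + d ≤ K)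
    (e : (pos (k + d)).2 = (pos k).2) : g (k + d) ≤ g k ∧ (0 < d → g (k + d) < g k) := by
  induction d with
  | zero => simp
  | succ d ih =>
    have h1 := (h.row_le_and_col_le d (by omega : k + d ≤ K)).2
    rw [← add_assoc] at e ⊢
    by_cases hu : up (k + d)
    · have := h.step_up (k + d) (by omega) hu
      have h3 := ((hg (k + d) (by omega)).1 hu).trans_le (ih (by omega) (by omega)).1
      exact ⟨h3.le, fun _ => h3⟩
    · have := h.step_right (k + d) (by omega) hu
      omega

theorem isSemistandard (h : IsRibbonPath θ K up pos) {M : Tableau θ ℕ+} {g : ℕ → ℕ+}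
    (hM : ∀ k (hk : k ≤ K), M ⟨pos k, h.mem k hk⟩ = g k)
    (hg : ∀ k < K, StepRel (up k) (g k) (g (k + 1))) : IsSemistandard M := by
  constructor
  · rintro ⟨x, hx⟩ ⟨y, hy⟩ e hlt
    obtain ⟨k, hk, rfl⟩ := h.surj x hx
    obtain ⟨k', hk', rfl⟩ := h.surj y hy
    simp only at e hlt
    rw [hM k hk, hM k' hk']
    have h1 := h.content hk
    have h2 := h.content hk'
    obtain ⟨d, rfl⟩ := Nat.exists_eq_add_of_le (show k ≤ k' by omega)
    exact h.le_of_row_eq hg d hk' e.symm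
  · rintro ⟨x, hx⟩ ⟨y, hy⟩ e hlt
    obtain ⟨k, hk, rfl⟩ := h.surj x hx
    obtain ⟨k', hk', rfl⟩ := h.surj y hy
    simp only at e hlt
    rw [hM k hk, hM k' hk']
    have h1 := h.content hk
    have h2 := h.content hk'
    obtain ⟨d, rfl⟩ := Nat.exists_eq_add_of_le (show k' ≤ k by omega)
    exact (h.le_of_col_eq hg d hk e).2 (by omega)

theorem stepRel (h : IsRibbonPath θ K up pos) {M : Tableau θ ℕ+} (hM : IsSemistandard M)
    (k : ℕ) (hk : k < K) :
    StepRel (up k) (M ⟨pos k, h.mem k hk.le⟩) (M ⟨pos (k + 1), h.mem (k + 1) hk⟩) := by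
  refine ⟨fun hu => ?_, fun hu => ?_⟩
  · obtain ⟨h1, h2⟩ := h.step_up k hk hu
    exact hM.col_strict _ _ h2.symm (by simp only; omega)
  · obtain ⟨h1, h2⟩ := h.step_right k hk hu
    exact hM.row_weak _ _ h1.symm (by simp only; omega)

/-- The entries of a tableau on a ribbon, read from its south-west end. -/
def read (h : IsRibbonPath θ K up pos) (M : SSYT θ) : Fin (K + 1) → ℕ+ :=
  fun k => M.1 ⟨pos k, h.mem k (Nat.lt_succ_iff.1 k.2)⟩

theorem read_injective (h : IsRibbonPath θ K up pos) : Function.Injective h.read := by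
  intro M M' e
  refine Subtype.ext (funext fun ⟨x, hx⟩ => ?_)
  obtain ⟨k, hk, rfl⟩ := h.surj x hx
  exact congrFun e ⟨k, Nat.lt_succ_iff.2 hk⟩

theorem mem_range_read (h : IsRibbonPath θ K up pos) {f : Fin (K + 1) → ℕ+}
    (hf : ∀ k : Fin K, StepRel (up k) (f k.castSucc) (f k.succ)) : f ∈ Set.range h.read := by
  choose idx hidx hpos using h.surj
  -- The value `1` beyond the end is never read.
  let g : ℕ → ℕ+ := fun k => if hk : k < K + 1 then f ⟨k, hk⟩ else 1
  let M : Tableau θ ℕ+ := fun x => g (idx x.1 x.2)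
  have hM : ∀ k (hk : k ≤ K), M ⟨pos k, h.mem k hk⟩ = g k := fun k hk => by
    simp only [M]
    rw [h.injOn (hidx _ (h.mem k hk)) hk (hpos _ _)]
  refine ⟨⟨M, h.isSemistandard hM fun k hk => ?_⟩, funext fun k => ?_⟩
  · have := hf ⟨k, hk⟩
    simpa [g, hk, hk.le] using this
  · have hk := Nat.lt_succ_iff.1 k.2
    change M ⟨pos k, h.mem k hk⟩ = f k
    rw [hM k hk]
    exact dif_pos k.2

theorem prod_eq (h : IsRibbonPath θ K up pos) (F : ↥θ → ℂ) :
    ∏ x, F x = ∏ k : Fin (K + 1), F ⟨pos k, h.mem k (Nat.lt_succ_iff.1 k.2)⟩ := by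
  symm
  refine Function.Bijective.prod_comp
    (e := fun k : Fin (K + 1) => (⟨pos k, h.mem k (Nat.lt_succ_iff.1 k.2)⟩ : ↥θ)) ⟨?_, ?_⟩ F
  · intro k k' e
    exact Fin.ext (h.injOn (Nat.lt_succ_iff.1 k.2) (Nat.lt_succ_iff.1 k'.2)
      (congrArg Subtype.val e))
  · rintro ⟨x, hx⟩
    obtain ⟨k, hk, rfl⟩ := h.surj x hx
    exact ⟨⟨k, Nat.lt_succ_iff.2 hk⟩, rfl⟩

end IsRibbonPath

/-- `x ↦ x ^ (-c_t)`. -/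
noncomputable def powWeight (c : ℤ → ℕ+) (t : ℤ) (x : ℕ+) : ℂ := 1 / ((x : ℕ) : ℂ) ^ (c t : ℕ)

/-- The Schur multiple zeta value of a ribbon is the limit of the sums over fillings with entries in
finite sets. -/
theorem IsRibbonPath.tendsto_chainSum {θ : Finset (ℕ × ℕ)} {K : ℕ} {up : ℕ → Prop}
    {pos : ℕ → ℕ × ℕ} (h : IsRibbonPath θ K up pos) {γ : Tableau θ ℕ+}
    (hγ : ZetaConverges (toComplex γ)) {P : ℤ → Prop} {c : ℤ → ℕ+} {l : ℤ}
    (hP : ∀ k < K, up k ↔ P (l + k)) (hc : ∀ k (hk : k ≤ K), γ ⟨pos k, h.mem k hk⟩ = c (l + k)) :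
    Filter.Tendsto (fun s : Finset ℕ+ => chainSum (powWeight c) P s l K) Filter.atTop
      (nhds (schurZeta (toComplex γ))) := by
  have hterm : (fun M : SSYT θ => weight (toComplex γ) M) =
      chainTerm (powWeight c) P l K ∘ h.read := by
    funext M
    have h1 : ∀ k : Fin K, stepInd ℂ (P (l + k)) (h.read M k.castSucc) (h.read M k.succ) = 1 := by
      intro k
      have := h.stepRel M.2 k k.2
      rw [propext (hP k k.2)] at this
      exact if_pos this
    simp only [Function.comp_apply, chainTerm, h1, Finset.prod_const_one, mul_one, weight]
    rw [h.prod_eq, one_div, ← Finset.prod_inv_distrib]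
    refine Finset.prod_congr rfl fun k _ => ?_
    simp only [toComplex, hc k (Nat.lt_succ_iff.1 k.2), Complex.cpow_natCast, powWeight, one_div]
    rfl
  have hsum : HasSum (chainTerm (powWeight c) P l K) (schurZeta (toComplex γ)) := by
    rw [← h.read_injective.hasSum_iff, ← hterm]
    · exact Summable.hasSum hγ
    -- A tuple that is not the reading of a semistandard tableau violates some step, so its term
    -- vanishes.
    · intro f hf
      by_contra hne
      refine hf (h.mem_range_read fun k => ?_)
      rw [propext (hP k k.2)]
      by_contra hk
      exact hne (mul_eq_zero_of_right _ (Finset.prod_eq_zero (Finset.mem_univ k) (if_neg hk)))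
  -- The cubes `s^(K+1)` eventually contain any finite set of tuples, so sums over cubes converge to
  -- the unconditional sum.
  have hlim : Filter.Tendsto (fun s : Finset ℕ+ => Fintype.piFinset fun _ : Fin (K + 1) => s)
      Filter.atTop Filter.atTop := by
    refine Filter.tendsto_atTop.2 fun S => ?_
    filter_upwards [Filter.eventually_ge_atTop (S.biUnion fun f => Finset.univ.image f)]
      with s hs f hf
    exact Fintype.mem_piFinset.2 fun k => hs (Finset.mem_biUnion.2
      ⟨f, hf, Finset.mem_image_of_mem _ (Finset.mem_univ k)⟩)
  have := Filter.Tendsto.comp hsum hlim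
  simpa only [Function.comp_def, sum_chainTerm] using this

/-! ### Winged hooks and reflected hooks as ribbons -/

theorem mem_hook {p q : ℕ} {x : ℕ × ℕ} :
    x ∈ (hook p q).cells ↔ x.1 ≤ q ∧ x.2 ≤ p ∧ (x.1 = 0 ∨ x.2 = 0) := by
  simp only [hook, Finset.mem_filter, Finset.mem_product, Finset.mem_range, Nat.lt_succ_iff,
    and_assoc]

theorem rowLen_eq_of_forall {lam : YoungDiagram} {i k : ℕ} (h : ∀ j, (i, j) ∈ lam ↔ j < k) :
    lam.rowLen i = k := by
  refine le_antisymm (not_lt.1 fun hlt => ?_) (not_lt.1 fun hlt => ?_)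
  · exact lt_irrefl k ((h k).1 (YoungDiagram.mem_iff_lt_rowLen.2 hlt))
  · exact lt_irrefl _ (YoungDiagram.mem_iff_lt_rowLen.1 ((h _).2 hlt))

theorem colLen_eq_of_forall {lam : YoungDiagram} {j k : ℕ} (h : ∀ i, (i, j) ∈ lam ↔ i < k) :
    lam.colLen j = k := by
  refine le_antisymm (not_lt.1 fun hlt => ?_) (not_lt.1 fun hlt => ?_)
  · exact lt_irrefl k ((h k).1 (YoungDiagram.mem_iff_lt_colLen.2 hlt))
  · exact lt_irrefl _ (YoungDiagram.mem_iff_lt_colLen.1 ((h _).2 hlt))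

theorem rowLen_hook (p q : ℕ) : (hook p q).rowLen 0 = p + 1 :=
  rowLen_eq_of_forall fun j => by
    rw [← YoungDiagram.mem_cells, mem_hook]
    simp

theorem colLen_hook (p q : ℕ) : (hook p q).colLen 0 = q + 1 :=
  colLen_eq_of_forall fun j => by
    rw [← YoungDiagram.mem_cells, mem_hook]
    simp

theorem mem_winged {m n : ℕ} {lam : YoungDiagram} {x : ℕ × ℕ} :
    x ∈ winged m lam n ↔ (n ≤ x.1 ∧ m ≤ x.2 ∧ (x.1 - n, x.2 - m) ∈ lam.cells) ∨
      (x.1 = n + (lam.colLen 0 - 1) ∧ x.2 < m) ∨ (x.1 < n ∧ x.2 = m + (lam.rowLen 0 - 1)) := by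
  obtain ⟨r, c⟩ := x
  simp only [winged, Finset.mem_union, Finset.mem_image, Finset.mem_range, Prod.mk.injEq, or_assoc]
  refine or_congr ⟨?_, ?_⟩ (or_congr ⟨?_, ?_⟩ ⟨?_, ?_⟩)
  · rintro ⟨y, hy, rfl, rfl⟩
    simpa using hy
  · rintro ⟨h1, h2, h3⟩
    exact ⟨_, h3, by simp only; omega, by simp only; omega⟩
  · rintro ⟨k, hk, rfl, rfl⟩
    exact ⟨rfl, hk⟩
  · rintro ⟨h1, h2⟩
    exact ⟨c, h2, h1.symm, rfl⟩
  · rintro ⟨k, hk, rfl, rfl⟩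
    exact ⟨hk, rfl⟩
  · rintro ⟨h1, h2⟩
    exact ⟨r, h1, rfl, h2.symm⟩

theorem mem_winged_hook {m n p q : ℕ} {x : ℕ × ℕ} :
    x ∈ winged m (hook p q) n ↔
      (n ≤ x.1 ∧ x.1 ≤ n + q ∧ x.2 = m) ∨ (x.1 = n ∧ m ≤ x.2 ∧ x.2 ≤ m + p) ∨
        (x.1 = n + q ∧ x.2 < m) ∨ (x.1 < n ∧ x.2 = m + p) := by
  rw [mem_winged, mem_hook, rowLen_hook, colLen_hook]
  simp only
  omega

/-- The winged hooks are ribbons. -/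
theorem isRibbonPath_winged_hook (m n p q : ℕ) :
    IsRibbonPath (winged m (hook p q) n) (m + q + p + n)
      (fun k => m ≤ k ∧ k < m + q ∨ m + q + p ≤ k)
      (fun k => (n + q - min (k - m) q - (k - (m + q + p)), min k m + min (k - (m + q)) p)) where
  mem k hk := by
    rw [mem_winged_hook]
    simp only
    omega
  surj x hx := by
    obtain ⟨r, c⟩ := x
    rw [mem_winged_hook] at hx
    simp only at hx
    -- The path starts at `(n + q, 0)`, so the index of a box is its content minus that of the
    -- start.
    refine ⟨n + q + c - r, by omega, ?_⟩
    simp only [Prod.mk.injEq]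
    omega
  step_up k hk hu := by
    simp only
    omega
  step_right k hk hu := by
    simp only
    omega

theorem lastRow_hook (p q : ℕ) : lastRow (hook p q).cells = q := by
  refine le_antisymm (Finset.sup_le fun x hx => (mem_hook.1 hx).1) ?_
  exact Finset.le_sup (f := Prod.fst) (b := (q, 0)) (mem_hook.2 (by simp))

theorem lastCol_hook (p q : ℕ) : lastCol (hook p q).cells = p := by
  refine le_antisymm (Finset.sup_le fun x hx => (mem_hook.1 hx).2.1) ?_
  exact Finset.le_sup (f := Prod.snd) (b := (0, p)) (mem_hook.2 (by simp))

theorem mem_sharp {θ : Finset (ℕ × ℕ)} {y : ℕ × ℕ} :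
    y ∈ sharp θ ↔ y.1 ≤ lastCol θ ∧ y.2 ≤ lastRow θ ∧ (lastRow θ - y.2, lastCol θ - y.1) ∈ θ := by
  constructor
  · intro hy
    refine ⟨?_, ?_, mem_of_mem_sharp hy⟩ <;>
    · obtain ⟨x, hx, rfl⟩ := Finset.mem_image.1 hy
      simp
  · rintro ⟨h1, h2, h3⟩
    refine Finset.mem_image.2 ⟨_, h3, ?_⟩
    ext <;> simp only <;> omega

theorem mem_sharp_hook {p q : ℕ} {x : ℕ × ℕ} :
    x ∈ sharp (hook p q).cells ↔ x.1 ≤ p ∧ x.2 ≤ q ∧ (x.1 = p ∨ x.2 = q) := by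
  rw [mem_sharp, mem_hook, lastRow_hook, lastCol_hook]
  simp only
  omega

/-- The reflected hooks are ribbons. -/
theorem isRibbonPath_sharp_hook (p q : ℕ) :
    IsRibbonPath (sharp (hook p q).cells) (q + p) (fun k => q ≤ k)
      (fun k => (p - (k - q), min k q)) where
  mem k hk := by
    rw [mem_sharp_hook]
    simp only
    omega
  surj x hx := by
    obtain ⟨r, c⟩ := x
    rw [mem_sharp_hook] at hx
    simp only at hx
    refine ⟨p + c - r, by omega, ?_⟩
    simp only [Prod.mk.injEq]
    omega
  step_up k hk hu := by
    simp only
    omega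
  step_right k hk hu := by
    simp only
    omega

/-! ### The reflected winged rectangle and its Frobenius coordinates -/

section Rectangle

variable {lam : YoungDiagram} {a b : ℕ}

theorem mem_rectangle (hlam : lam.cells = Finset.range a ×ˢ Finset.range b) {i j : ℕ} :
    (i, j) ∈ lam ↔ i < a ∧ j < b := by
  rw [← YoungDiagram.mem_cells, hlam]
  simp

theorem rowLen_rectangle (hlam : lam.cells = Finset.range a ×ˢ Finset.range b) {i : ℕ}
    (hi : i < a) : lam.rowLen i = b :=
  rowLen_eq_of_forall fun j => by rw [mem_rectangle hlam]; omega

theorem colLen_rectangle (hlam : lam.cells = Finset.range a ×ˢ Finset.range b) {j : ℕ}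
    (hj : j < b) : lam.colLen j = a :=
  colLen_eq_of_forall fun i => by rw [mem_rectangle hlam]; omega

theorem diagLen_eq_of_forall {nu : YoungDiagram} {N : ℕ} (h : ∀ i, (i, i) ∈ nu ↔ i < N) :
    diagLen nu = N := by
  have : nu.cells.filter (fun x => x.1 = x.2) = (Finset.range N).image fun i => (i, i) := by
    ext ⟨i, j⟩
    simp only [Finset.mem_filter, YoungDiagram.mem_cells, Finset.mem_image, Finset.mem_range,
      Prod.mk.injEq]
    constructor
    · rintro ⟨h1, rfl⟩
      exact ⟨i, (h i).1 h1, rfl, rfl⟩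
    · rintro ⟨k, hk, rfl, rfl⟩
      exact ⟨(h k).2 hk, rfl⟩
  rw [diagLen, this, Finset.card_image_of_injective _ fun i j e => congrArg Prod.fst e,
    Finset.card_range]

theorem mem_winged_rectangle (hlam : lam.cells = Finset.range a ×ˢ Finset.range b) (ha : 0 < a)
    (hb : 0 < b) {m n : ℕ} {x : ℕ × ℕ} :
    x ∈ winged m lam n ↔ (n ≤ x.1 ∧ m ≤ x.2 ∧ x.1 < n + a ∧ x.2 < m + b) ∨
      (x.1 = n + (a - 1) ∧ x.2 < m) ∨ (x.1 < n ∧ x.2 = m + (b - 1)) := by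
  rw [mem_winged, YoungDiagram.mem_cells, mem_rectangle hlam, rowLen_rectangle hlam ha,
    colLen_rectangle hlam hb]
  omega

theorem lastRow_winged_rectangle (hlam : lam.cells = Finset.range a ×ˢ Finset.range b)
    (ha : 0 < a) (hb : 0 < b) (m n : ℕ) : lastRow (winged m lam n) = n + (a - 1) := by
  refine le_antisymm (Finset.sup_le fun x hx => ?_) ?_
  · rw [mem_winged_rectangle hlam ha hb] at hx
    omega
  · exact Finset.le_sup (f := Prod.fst) (b := (n + (a - 1), m))
      ((mem_winged_rectangle hlam ha hb).2 (by simp only; omega))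

theorem lastCol_winged_rectangle (hlam : lam.cells = Finset.range a ×ˢ Finset.range b)
    (ha : 0 < a) (hb : 0 < b) (m n : ℕ) : lastCol (winged m lam n) = m + (b - 1) := by
  refine le_antisymm (Finset.sup_le fun x hx => ?_) ?_
  · rw [mem_winged_rectangle hlam ha hb] at hx
    omega
  · exact Finset.le_sup (f := Prod.snd) (b := (n, m + (b - 1)))
      ((mem_winged_rectangle hlam ha hb).2 (by simp only; omega))

theorem mem_sharp_winged_rectangle (hlam : lam.cells = Finset.range a ×ˢ Finset.range b)
    (ha : 0 < a) (hb : 0 < b) {m n : ℕ} {x : ℕ × ℕ} :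
    x ∈ sharp (winged m lam n) ↔ (x.1 < b ∧ x.2 < a) ∨ (x.1 < b + m ∧ x.2 = 0) ∨
      (x.1 = 0 ∧ x.2 < a + n) := by
  rw [mem_sharp, mem_winged_rectangle hlam ha hb, lastRow_winged_rectangle hlam ha hb,
    lastCol_winged_rectangle hlam ha hb]
  simp only
  omega

/-- The partition `(a + n, a^{b-1}, 1^m)`. -/
def sharpWinged (hlam : lam.cells = Finset.range a ×ˢ Finset.range b) (ha : 0 < a) (hb : 0 < b)
    (m n : ℕ) : YoungDiagram where
  cells := sharp (winged m lam n)
  isLowerSet := by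
    rintro ⟨i, j⟩ ⟨i', j'⟩ ⟨h1, h2⟩ h
    simp only [Finset.mem_coe, mem_sharp_winged_rectangle hlam ha hb] at *
    omega

variable (hlam : lam.cells = Finset.range a ×ˢ Finset.range b) (ha : 0 < a) (hb : 0 < b) (m n : ℕ)

theorem mem_sharpWinged {i j : ℕ} : (i, j) ∈ sharpWinged hlam ha hb m n ↔
    (i < b ∧ j < a) ∨ (i < b + m ∧ j = 0) ∨ (i = 0 ∧ j < a + n) := by
  rw [← YoungDiagram.mem_cells]
  exact mem_sharp_winged_rectangle hlam ha hb

theorem frobP_sharpWinged {i : ℕ} (hi : i < min a b) :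
    frobP (sharpWinged hlam ha hb m n) i = a - 1 - i + if i = 0 then n else 0 := by
  have : (sharpWinged hlam ha hb m n).rowLen i = a + if i = 0 then n else 0 :=
    rowLen_eq_of_forall fun j => by
      rw [mem_sharpWinged]
      split_ifs <;> omega
  rw [frobP, this]
  omega

theorem frobQ_sharpWinged {j : ℕ} (hj : j < min a b) :
    frobQ (sharpWinged hlam ha hb m n) j = b - 1 - j + if j = 0 then m else 0 := by
  have : (sharpWinged hlam ha hb m n).colLen j = b + if j = 0 then m else 0 :=
    colLen_eq_of_forall fun i => by
      rw [mem_sharpWinged]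
      split_ifs <;> omega
  rw [frobQ, this]
  omega

end Rectangle

theorem Tableau.apply_of_sharp_eq_content {θ : Finset (ℕ × ℕ)} {X : Type*} {sT : Tableau θ X}
    {c : ℤ → X} (h : contentTableau (SchurMZF.sharp θ) c = Tableau.sharp sT) (x : ↥θ) :
    sT x = c (((lastRow θ : ℤ) - x.1.1) - ((lastCol θ : ℤ) - x.1.2)) := by
  have h1 : x.1.1 ≤ lastRow θ := Finset.le_sup (f := Prod.fst) x.2
  have h2 : x.1.2 ≤ lastCol θ := Finset.le_sup (f := Prod.snd) x.2
  have := congrFun h ⟨(lastCol θ - x.1.2, lastRow θ - x.1.1), Finset.mem_image.2 ⟨x.1, x.2, rfl⟩⟩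
  simp only [contentTableau, Tableau.sharp, Nat.sub_sub_self h1, Nat.sub_sub_self h2] at this
  rw [← Nat.cast_sub h1, ← Nat.cast_sub h2]
  exact this.symm

theorem ite_zero_cases (j m : ℕ) :
    (j = 0 ∧ (if j = 0 then m else 0) = m) ∨ (j ≠ 0 ∧ (if j = 0 then m else 0) = 0) := by
  split_ifs with h <;> simp [h]

/-! ### Entries of the winged hooks and the interpolating step patterns -/

section Rectangle

variable {lam : YoungDiagram} {a b m n : ℕ}

/-- The entries of `[s_* | s | s^*]` when its reflection is constant along diagonals. -/
theorem wingedTableau_entries (hlam : lam.cells = Finset.range a ×ˢ Finset.range b) (ha : 0 < a)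
    (hb : 0 < b) {X : Type*} {c z : ℤ → X} {sl : Fin m → X} {su : Fin n → X}
    (h : contentTableau (sharp (winged m lam n)) c =
      Tableau.sharp (wingedTableau sl (contentTableau lam.cells z) su)) :
    (∀ i j : ℕ, i < a → j < b → z ((j : ℤ) - i) = c ((j : ℤ) - i + a - b)) ∧
      (∀ k : Fin m, sl k = c ((k : ℤ) - (m + b - 1))) ∧
      ∀ k : Fin n, su k = c (n + a - 1 - (k : ℤ)) := by
  have hval := Tableau.apply_of_sharp_eq_content h
  rw [lastRow_winged_rectangle hlam ha hb, lastCol_winged_rectangle hlam ha hb] at hval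
  have hmem := @mem_winged_rectangle lam a b hlam ha hb m n
  refine ⟨fun i j hi hj => ?_, fun k => ?_, fun k => ?_⟩
  · have := hval ⟨(n + i, m + j), hmem.2 (by simp only; omega)⟩
    simp only [wingedTableau, contentTableau, Nat.add_sub_cancel_left] at this
    rw [dif_neg (by omega), dif_neg (by omega)] at this
    rw [this]
    congr 1
    omega
  · have := hval ⟨(n + (a - 1), k), hmem.2 (Or.inr (Or.inl ⟨rfl, k.2⟩))⟩
    simp only [wingedTableau] at this
    rw [dif_pos k.2] at this
    rw [this]
    congr 1
    omega
  · have := hval ⟨(k, m + (b - 1)), hmem.2 (Or.inr (Or.inr ⟨k.2, rfl⟩))⟩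
    simp only [wingedTableau] at this
    rw [dif_neg (by omega), dif_pos k.2] at this
    rw [this]
    congr 1
    omega

/-- Body and wings obey one rule: the exponent is `c` at the content relative to the hook's vertex,
shifted by `a - b`. The shift appears because the reflection sends the south-east box of the
rectangle, of content `b - a`, to the box of content `0`. -/
theorem tildeHook_apply (hlam : lam.cells = Finset.range a ×ˢ Finset.range b)
    {X : Type*} {c z : ℤ → X} {sl : Fin m → X} {su : Fin n → X}
    (hz : ∀ i j : ℕ, i < a → j < b → z ((j : ℤ) - i) = c ((j : ℤ) - i + a - b))
    (hsl : ∀ k : Fin m, sl k = c ((k : ℤ) - (m + b - 1)))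
    (hsu : ∀ k : Fin n, su k = c (n + a - 1 - (k : ℤ)))
    {i j : ℕ} (hi : i < min a b) (hj : j < min a b)
    (x : ↥(winged (if j = 0 then m else 0) (hook (frobP lam i) (frobQ lam j))
      (if i = 0 then n else 0))) :
    tildeHook lam sl z su i j x =
      c (((x.1.2 : ℤ) - (if j = 0 then m else 0 : ℕ)) -
        ((x.1.1 : ℤ) - (if i = 0 then n else 0 : ℕ)) + a - b) := by
  obtain ⟨⟨r, k⟩, hx⟩ := x
  have hp : frobP lam i = b - (i + 1) := by rw [frobP, rowLen_rectangle hlam (by omega)]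
  have hq : frobQ lam j = a - (j + 1) := by rw [frobQ, colLen_rectangle hlam (by omega)]
  have hx' := mem_winged_hook.1 hx
  rw [hp, hq] at hx'
  simp only at hx'
  have hm := ite_zero_cases j m
  have hn := ite_zero_cases i n
  simp only [tildeHook, wingedTableau]
  by_cases h1 : k < if j = 0 then m else 0
  · rw [dif_pos h1, wingIf, hsl]
    refine congrArg c ?_
    simp only [Fin.val_castLE]
    omega
  · rw [dif_neg h1]
    by_cases h2 : r < if i = 0 then n else 0
    · rw [dif_pos h2, wingIf, hsu]
      refine congrArg c ?_
      simp only [Fin.val_castLE]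
      omega
    · rw [dif_neg h2]
      simp only [contentTableau]
      rw [hz _ _ (by omega) (by omega)]
      refine congrArg c ?_
      omega

/-- Interpolates between the step patterns of the winged hooks (`h = 0`) and of the reflected hooks
(`h = min a b - 1`). -/
def stepPattern (a b h : ℕ) (t : ℤ) : Prop :=
  ((h : ℤ) - (b - 1) ≤ t ∧ t < a - b) ∨ (a : ℤ) - 1 - h ≤ t

theorem strictAntiOn_frob (e w N : ℕ) (h : N ≤ e) :
    StrictAntiOn (fun i => e - 1 - i + if i = 0 then w else 0) (Set.Iio N) := by
  intro i hi j hj hij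
  simp only [Set.mem_Iio] at hi hj ⊢
  split_ifs <;> omega

/-- Passing from `h` to `h + 1` changes the pattern only at `h - (b - 1)` and `a - 2 - h`. These are
the steps just before box `-q_k` and just after box `p_k` for `k = h + 1`, so each passage is one
double reversal. -/
theorem det_chainMatrix_stepPattern {ι R : Type*} [LinearOrder ι] [CommRing R] (w : ℤ → ι → R)
    (s : Finset ι) (a b m n h : ℕ) (hh : h < min a b) :
    (chainMatrix w (stepPattern a b h) s (fun j => b - 1 - j + if j = 0 then m else 0)
      (fun i => a - 1 - i + if i = 0 then n else 0) :
        Matrix (Fin (min a b)) (Fin (min a b)) R).det =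
    (chainMatrix w (stepPattern a b 0) s (fun j => b - 1 - j + if j = 0 then m else 0)
      (fun i => a - 1 - i + if i = 0 then n else 0) :
        Matrix (Fin (min a b)) (Fin (min a b)) R).det := by
  induction h with
  | zero => rfl
  | succ h ih =>
    rw [← ih (by omega)]
    refine det_chainMatrix_flip_both w s (strictAntiOn_frob b m _ (min_le_right a b))
      (strictAntiOn_frob a n _ (min_le_left a b)) ⟨h + 1, hh⟩ ?_ ?_ fun u h1 h2 => ?_
    · simp only [stepPattern, Nat.succ_ne_zero, if_false]
      omega
    · simp only [stepPattern, Nat.succ_ne_zero, if_false]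
      omega
    · simp only [stepPattern, Nat.succ_ne_zero, if_false] at h1 h2 ⊢
      omega

theorem tendsto_chainSum_tildeHook (hlam : lam.cells = Finset.range a ×ˢ Finset.range b)
    {c z : ℤ → ℕ+} {sl : Fin m → ℕ+} {su : Fin n → ℕ+}
    (hz : ∀ i j : ℕ, i < a → j < b → z ((j : ℤ) - i) = c ((j : ℤ) - i + a - b))
    (hsl : ∀ k : Fin m, sl k = c ((k : ℤ) - (m + b - 1)))
    (hsu : ∀ k : Fin n, su k = c (n + a - 1 - (k : ℤ)))
    {i j : ℕ} (hi : i < min a b) (hj : j < min a b)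
    (hconv : ZetaConverges (toComplex (tildeHook lam sl z su i j))) :
    Filter.Tendsto (fun s : Finset ℕ+ => chainSum (powWeight c) (stepPattern a b 0) s
        (-((b - 1 - j + if j = 0 then m else 0 : ℕ) : ℤ))
        ((b - 1 - j + if j = 0 then m else 0) + (a - 1 - i + if i = 0 then n else 0)))
      Filter.atTop (nhds (schurZeta (toComplex (tildeHook lam sl z su i j)))) := by
  have hp : frobP lam i = b - (i + 1) := by rw [frobP, rowLen_rectangle hlam (by omega)]
  have hq : frobQ lam j = a - (j + 1) := by rw [frobQ, colLen_rectangle hlam (by omega)]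
  have hrib := isRibbonPath_winged_hook (if j = 0 then m else 0) (if i = 0 then n else 0)
    (frobP lam i) (frobQ lam j)
  have hK : (if j = 0 then m else 0) + frobQ lam j + frobP lam i + (if i = 0 then n else 0) =
      (b - 1 - j + if j = 0 then m else 0) + (a - 1 - i + if i = 0 then n else 0) := by
    rw [hp, hq]
    omega
  have hm := ite_zero_cases j m
  have hn := ite_zero_cases i n
  rw [← hK]
  refine hrib.tendsto_chainSum hconv (fun k hk => ?_) fun k hk => ?_
  · rw [hp, hq] at hk ⊢
    simp only [stepPattern]
    omega
  · rw [tildeHook_apply hlam hz hsl hsu hi hj]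
    have h1 := hrib.content hk
    refine congrArg c ?_
    simp only [Nat.zero_sub, Nat.zero_min, Nat.sub_zero, add_zero, zero_add] at h1
    dsimp only
    -- Only the content of the box matters, so its explicit row and column are made opaque.
    generalize min k _ + min _ _ = y at h1 ⊢
    generalize _ - (k - _) = x at h1 ⊢
    rw [hq] at h1
    push_cast
    omega

theorem tendsto_chainSum_sharpHook (mu : YoungDiagram) {c : ℤ → ℕ+} {i j p q : ℕ}
    (hp : frobP mu i = p) (hq : frobQ mu j = q) {P : ℤ → Prop}
    (hP : ∀ t, P t ↔ 0 ≤ t) (hconv : ZetaConverges (toComplex (sharpHook mu c i j))) :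
    Filter.Tendsto (fun s : Finset ℕ+ => chainSum (powWeight c) P s (-(q : ℤ)) (q + p))
      Filter.atTop (nhds (schurZeta (toComplex (sharpHook mu c i j)))) := by
  subst hp hq
  refine (isRibbonPath_sharp_hook (frobP mu i) (frobQ mu j)).tendsto_chainSum hconv
    (fun k hk => ?_) fun k hk => ?_
  · rw [hP]
    omega
  · simp only [sharpHook, Tableau.sharp, contentTableau, lastRow_hook, lastCol_hook]
    congr 1
    omega

theorem admissible_sharpHook (mu : YoungDiagram) {c : ℤ → ℕ+} (hc : 2 ≤ c 0) (i j : ℕ) :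
    Admissible (sharpHook mu c i j) := by
  rintro ⟨⟨r, k⟩, hx⟩ ⟨-, h1, h2⟩
  rw [mem_sharp_hook] at hx h1 h2
  simp only at hx h1 h2
  simp only [sharpHook, Tableau.sharp, contentTableau, lastRow_hook, lastCol_hook]
  convert hc using 2
  omega

/-- The innermost hook is a single row or column before wings are attached, as `N = min a b`. Its
south-east end is a corner carrying `c 0`, and `c 0` is also the entry at the only corner of every
reflected hook. -/
theorem two_le_of_admissible_tildeHook (hlam : lam.cells = Finset.range a ×ˢ Finset.range b)
    (ha : 0 < a) (hb : 0 < b) {c z : ℤ → ℕ+} {sl : Fin m → ℕ+} {su : Fin n → ℕ+}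
    (hz : ∀ i j : ℕ, i < a → j < b → z ((j : ℤ) - i) = c ((j : ℤ) - i + a - b))
    (hsl : ∀ k : Fin m, sl k = c ((k : ℤ) - (m + b - 1)))
    (hsu : ∀ k : Fin n, su k = c (n + a - 1 - (k : ℤ)))
    (hadm : Admissible (tildeHook lam sl z su (min a b - 1) (min a b - 1))) : 2 ≤ c 0 := by
  set N := min a b with hN
  have hp : frobP lam (N - 1) = b - N := by
    rw [frobP, rowLen_rectangle hlam (by omega)]; omega
  have hq : frobQ lam (N - 1) = a - N := by
    rw [frobQ, colLen_rectangle hlam (by omega)]; omega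
  have hmem : ((if N - 1 = 0 then n else 0) + (a - N), (if N - 1 = 0 then m else 0) + (b - N)) ∈
      winged (if N - 1 = 0 then m else 0) (hook (frobP lam (N - 1)) (frobQ lam (N - 1)))
        (if N - 1 = 0 then n else 0) := by
    rw [hp, hq, mem_winged_hook]
    simp only
    omega
  have := hadm ⟨_, hmem⟩ ⟨hmem, fun h => by rw [mem_winged_hook] at h; simp only at h; omega,
    fun h => by rw [mem_winged_hook] at h; simp only at h; omega⟩
  rw [tildeHook_apply hlam hz hsl hsu (by omega) (by omega)] at this
  convert this using 2
  push_cast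
  omega

end Rectangle

/-! ### Passage to the limit -/

theorem tendsto_det {α : Type*} {F : Filter α} {N : ℕ} {A : α → Matrix (Fin N) (Fin N) ℂ}
    {B : Matrix (Fin N) (Fin N) ℂ}
    (h : ∀ i j, Filter.Tendsto (fun s => A s i j) F (nhds (B i j))) :
    Filter.Tendsto (fun s => (A s).det) F (nhds B.det) :=
  ((continuous_id.matrix_det).tendsto B).comp
    (tendsto_pi_nhds.2 fun i => tendsto_pi_nhds.2 fun j => h i j)

end SchurMZF

theorem theorem4p1 (lam : YoungDiagram) (hlam : IsRectangle lam) (m n : ℕ) :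
    ∃ mu : YoungDiagram,
      mu.cells = sharp (winged m lam n) ∧
      diagLen mu = diagLen lam ∧
      ∀ (γ : Tableau (sharp (winged m lam n)) ℕ+) (sT : Tableau (winged m lam n) ℕ+)
        (c z : ℤ → ℕ+) (sl : Fin m → ℕ+) (su : Fin n → ℕ+),
        γ = contentTableau (sharp (winged m lam n)) c →
        γ = Tableau.sharp sT →
        sT = wingedTableau sl (contentTableau lam.cells z) su →
        (∀ i j : Fin (diagLen lam), Admissible (tildeHook lam sl z su i j)) →
        (∀ i j : Fin (diagLen lam), ZetaConverges (toComplex (tildeHook lam sl z su i j))) ∧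
        (∀ i j : Fin (diagLen mu), ZetaConverges (toComplex (sharpHook mu c i j))) ∧
        Matrix.det (Matrix.of fun i j : Fin (diagLen lam) =>
            schurZeta (toComplex (tildeHook lam sl z su i j))) =
          Matrix.det (Matrix.of fun i j : Fin (diagLen mu) =>
            schurZeta (toComplex (sharpHook mu c i j))) := by
  obtain ⟨a, b, ha, hb, hlam⟩ := hlam
  have hN : diagLen lam = min a b :=
    diagLen_eq_of_forall fun i => by rw [mem_rectangle hlam]; omega
  have hN' : diagLen (sharpWinged hlam ha hb m n) = min a b :=
    diagLen_eq_of_forall fun i => by rw [mem_sharpWinged]; omega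
  refine ⟨sharpWinged hlam ha hb m n, rfl, hN'.trans hN.symm, ?_⟩
  intro γ sT c z sl su hγ hγ' hsT hadm
  subst hsT
  obtain ⟨hz, hsl, hsu⟩ := wingedTableau_entries hlam ha hb (hγ.symm.trans hγ')
  rw [hN] at hadm ⊢
  rw [hN']
  have hc : 2 ≤ c 0 := two_le_of_admissible_tildeHook hlam ha hb hz hsl hsu
    (hadm ⟨min a b - 1, by omega⟩ ⟨min a b - 1, by omega⟩)
  refine ⟨fun i j => (hadm i j).zetaConverges,
    fun i j => (admissible_sharpHook _ hc i j).zetaConverges, ?_⟩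
  have hleft := tendsto_det (F := Filter.atTop)
    (A := fun s : Finset ℕ+ => chainMatrix (powWeight c) (stepPattern a b 0) s
      (fun j => b - 1 - j + if j = 0 then m else 0) (fun i => a - 1 - i + if i = 0 then n else 0))
    (B := Matrix.of fun i j : Fin (min a b) => schurZeta (toComplex (tildeHook lam sl z su i j)))
    fun i j => tendsto_chainSum_tildeHook hlam hz hsl hsu i.2 j.2 (hadm i j).zetaConverges
  have hright := tendsto_det (F := Filter.atTop)
    (A := fun s : Finset ℕ+ => chainMatrix (powWeight c) (stepPattern a b (min a b - 1)) s
      (fun j => b - 1 - j + if j = 0 then m else 0) (fun i => a - 1 - i + if i = 0 then n else 0))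
    (B := Matrix.of fun i j : Fin (min a b) =>
      schurZeta (toComplex (sharpHook (sharpWinged hlam ha hb m n) c i j))) fun i j =>
    tendsto_chainSum_sharpHook _ (frobP_sharpWinged hlam ha hb m n i.2)
      -- At `h = min a b - 1` the pattern reduces to `0 ≤ t`: for `b ≤ a` its two ranges join at `a
      -- - b`, and for `a ≤ b` the first one is empty.
      (frobQ_sharpWinged hlam ha hb m n j.2) (fun t => by simp only [stepPattern]; omega)
      (admissible_sharpHook _ hc i j).zetaConverges
  refine tendsto_nhds_unique hleft (hright.congr fun s => ?_)
  exact det_chainMatrix_stepPattern (powWeight c) s a b m n (min a b - 1) (by omega)
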